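/- Let $\alpha\in(0,\tfrac12)$ and let $X$ be a real random variable with distribution function $F_X$. For a distribution function $F$ put $\mathrm{VaR}_u(F)=\inf\{t\in\mathbb R: F(t)\ge u\}$, $\mathrm{VaR}_u(X)=\mathrm{VaR}_u(F_X)$, $$\mathrm{ES}_\alpha(F)=\frac1\alpha\int_{1-\alpha}^1\mathrm{VaR}_u(F)\,du,\qquad \mathrm{ES}_\alpha(X)=\mathrm{ES}_\alpha(F_X),$$ $$\sigma^2_{\mathrm{ES}_\alpha(X)}=\frac1{\alpha^2}\int_{\mathrm{VaR}_{1-\alpha}(X)}^\infty\int_{\mathrm{VaR}_{1-\alpha}(X)}^\infty \bigl(F_X(\min\{t,s\})-F_X(t)F_X(s)\bigr)\,dt\,ds\in[0,\infty].$$ *The estimator.* Let $x_1,\dots,x_N\in\mathbb R$ be data, let $\varepsilon>0$ and let $0.35\le\beta_1\le\beta_2\le0.65$. For a nonempty set $I$ of indices let $\widehat F_I(t)=\frac1{|I|}\,|\{i\in I:x_i\le t\}|$ and $\widehat T_I=\mathrm{ES}_\alpha(\widehat F_I)$. Put $\widehat T_N=\widehat T_{\{1,\dots,N\}}$, $m=\lceil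 11/\varepsilon^2\rceil$, $n=\lfloor N/m\rfloor$, and $I_j=\{(j-1)m+1,\dots,jm\}$ for $1\le j\le n$. Let $\widehat T_{(1)}\le\dots\le\widehat T_{(n)}$ be the order statistics of $\widehat T_{I_1},\dots,\widehat T_{I_n}$, and let $\widehat Q:[0,1]\to\mathbb R$ be the function with $\widehat Q\bigl(\tfrac{j-1}{n-1}\bigr)=\widehat T_{(j)}$ for $1\le j\le n$ that is linear between these points ($\widehat Q$ is constant if $n=1$; the case $n=0$, where it can be defined arbitrarily, is irrelevant for the limit below). The estimator is $$\widehat S_N=\min\bigl\{\max\{\widehat T_N,\widehat Q(\beta_1)\},\widehat Q(\beta_2)\bigr\}.$$ *Statement.* Let $X_1,X_2,\dots$ be i.i.d. copies of $X$. Assume that $\sigma^2_{\mathrm{ES}_\alpha(X)}<\infty$ and that $u\mapsto\mathrm{VaR}_u(X)$ is Lipschitz continuous on a neighbourhood of $1-\alpha$. Let $(K_N)$ be a sequence of nonnegative integers with $K_N\ge1$ for all large $N$ and $\lim_{N\to\infty}K_N/N=0$. For every $N$ let $\widetilde X^N_1,\dots,\widetilde X^N_N$ be modified data such that, almost surely,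 $\widetilde X^N_i\ne X_i$ for at most $K_N$ indices $i\in\{1,\dots,N\}$; the modification is otherwise arbitrary and may depend on all of the data and on the estimator. Let $\widehat S_N$ be computed from $\widetilde X^N_1,\dots,\widetilde X^N_N$ with $\varepsilon=\varepsilon_N:=12\sqrt{K_N/N}$ and fixed $\beta_1,\beta_2$. Then the integral defining $\mathrm{ES}_\alpha(X)$ converges, and $$\widehat S_N\longrightarrow\mathrm{ES}_\alpha(X)\quad\text{in probability as }N\to\infty .$$ -/

import Mathlib

open MeasureTheory ProbabilityTheory Filter Topology
open scoped NNReal ENNReal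

namespace ExpectedShortfall

noncomputable section

/-- The value at risk at level `u` of a distribution function `F`, that is, the lower quantile
`inf {t : F t ≥ u}`. -/
def VaR (F : ℝ → ℝ) (u : ℝ) : ℝ := sInf {t : ℝ | u ≤ F t}

/-- The expected shortfall at level `α` of a distribution function `F`. -/
def ES (α : ℝ) (F : ℝ → ℝ) : ℝ := 1 / α * ∫ u in (1 - α)..1, VaR F u

/-- The variance associated to the estimation of the expected shortfall, with values in `[0, ∞]`.
For a distribution function the integrand is nonnegative, so that `ENNReal.ofReal` does not
change it. -/
def sigmaSq (α : ℝ) (F : ℝ → ℝ) : ℝ≥0∞ :=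
  ENNReal.ofReal (1 / α ^ 2) *
    ∫⁻ t in Set.Ioi (VaR F (1 - α)), ∫⁻ s in Set.Ioi (VaR F (1 - α)),
      ENNReal.ofReal (F (min t s) - F t * F s)

/-- The empirical distribution function of the data points `x i` with index `i` in `I`. -/
def empiricalCDF {ι : Type*} (x : ι → ℝ) (I : Finset ι) (t : ℝ) : ℝ :=
  ((I.filter fun i => x i ≤ t).card : ℝ) / (I.card : ℝ)

/-- The plug-in estimator of the expected shortfall that uses the data points with index in `I`. -/
def plugIn {ι : Type*} (α : ℝ) (x : ι → ℝ) (I : Finset ι) : ℝ := ES α (empiricalCDF x I)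

/-- The `j`-th block of length `m` (blocks and data points are counted from `0`):
`{j m, ..., (j + 1) m - 1}`. It has exactly `m` elements when `(j + 1) m ≤ N`. -/
def block (N m j : ℕ) : Finset (Fin N) :=
  Finset.univ.filter fun i => j * m ≤ (i : ℕ) ∧ (i : ℕ) < (j + 1) * m

/-- The order statistics of `T`, counted from `0` (and `0` when the index is out of range):
`Tuple.sort T` is a permutation for which `T ∘ Tuple.sort T` is monotone. -/
def orderStat {n : ℕ} (T : Fin n → ℝ) (k : ℕ) : ℝ :=
  if h : k < n then T (Tuple.sort T ⟨k, h⟩) else 0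

/-- The linearly interpolated empirical quantile function on `[0, 1]`: its value at
`k / (n - 1)` is the order statistic with index `k` (counted from `0`), for `k = 0, ..., n - 1`,
and it is linear in between. -/
def quantile {n : ℕ} (T : Fin n → ℝ) (β : ℝ) : ℝ :=
  let h : ℝ := β * ((n : ℝ) - 1)
  let k : ℕ := ⌊h⌋₊
  orderStat T k + (h - k) * (orderStat T (k + 1) - orderStat T k)

/-- The block size `m = ⌈11 / ε ^ 2⌉`. -/
def blockSize (ε : ℝ) : ℕ := ⌈11 / ε ^ 2⌉₊

/-- The plug-in estimators on the `n = ⌊N / m⌋` disjoint blocks of length `m`. -/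
def blockEstimates (α ε : ℝ) {N : ℕ} (x : Fin N → ℝ) (j : Fin (N / blockSize ε)) : ℝ :=
  plugIn α x (block N (blockSize ε) j)

/-- The estimator: the plug-in estimator on the whole data set, truncated at the `β₁`- and
`β₂`-quantiles of the block estimators. -/
def estimator (α β₁ β₂ ε : ℝ) {N : ℕ} (x : Fin N → ℝ) : ℝ :=
  min (max (plugIn α x Finset.univ) (quantile (blockEstimates α ε x) β₁))
    (quantile (blockEstimates α ε x) β₂)

end

end ExpectedShortfall

/-!
The quantile transform turns `α * ES α (cdf μ)` into the Rockafellar–Uryasev minimum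
`min_c (α * c + ∫ x, max (x - c) 0 ∂μ)`, attained at `c = VaR (cdf μ) (1 - α)`. Comparing minimisers
gives continuity of the expected shortfall along convergent expected excesses and distribution
functions, so the strong law of large numbers makes every plug-in estimate on a clean block
consistent.

Changing `K` data points spoils at most `K` blocks, while `ε = 12 * √(K / N)` makes the number of
blocks asymptotically `144 / 11 * K`: fewer than one block in twelve is spoiled. By Markov's
inequality the clean blocks with a bad estimate are, with high probability, an arbitrarily small
proportion of all blocks. Hence both quantiles of the block estimates are close to the expected
shortfall, and so is any number truncated between them.
-/

namespace ExpectedShortfall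

open Set

section Quantile

variable {μ : Measure ℝ} {u : ℝ}

theorem VaR_le_iff (hu : u ∈ Ioo 0 1) {t : ℝ} : VaR (cdf μ) u ≤ t ↔ u ≤ cdf μ t := by
  have hne : {t : ℝ | u ≤ cdf μ t}.Nonempty := by
    obtain ⟨t, ht⟩ := ((tendsto_cdf_atTop μ).eventually_const_lt hu.2).exists
    exact ⟨t, ht.le⟩
  have hbdd : BddBelow {t : ℝ | u ≤ cdf μ t} := by
    obtain ⟨a, ha⟩ := ((tendsto_cdf_atBot μ).eventually_lt_const hu.1).exists
    exact ⟨a, fun t ht => ((monotone_cdf μ).reflect_lt (ha.trans_le ht)).le⟩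
  refine ⟨fun h => le_trans ?_ (monotone_cdf μ h), fun h => csInf_le hbdd h⟩
  have hright : Tendsto (cdf μ) (𝓝[>] VaR (cdf μ) u) (𝓝 (cdf μ (VaR (cdf μ) u))) :=
    ((cdf μ).right_continuous _).mono Ioi_subset_Ici_self
  refine ge_of_tendsto hright ?_
  filter_upwards [self_mem_nhdsWithin] with t ht
  obtain ⟨s, hs, hst⟩ := exists_lt_of_csInf_lt hne ht
  exact hs.trans (monotone_cdf μ hst.le)

theorem lt_VaR_iff (hu : u ∈ Ioo 0 1) {t : ℝ} : t < VaR (cdf μ) u ↔ cdf μ t < u := by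
  rw [← not_le, VaR_le_iff hu, not_le]

theorem monotoneOn_VaR : MonotoneOn (VaR (cdf μ)) (Ioo 0 1) := fun _ hu _ hw huw =>
  (VaR_le_iff hu).2 (huw.trans ((VaR_le_iff hw).1 le_rfl))

theorem aemeasurable_VaR : AEMeasurable (VaR (cdf μ)) (volume.restrict (Ioo 0 1)) :=
  aemeasurable_restrict_of_monotoneOn measurableSet_Ioo monotoneOn_VaR

theorem map_VaR_restrict_volume [IsProbabilityMeasure μ] :
    (volume.restrict (Ioo (0 : ℝ) 1)).map (VaR (cdf μ)) = μ := by
  refine (Measure.ext_of_Iic _ _ fun t => ?_).symm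
  have hpreimage : (VaR (cdf μ) ⁻¹' Iic t ∩ Ioo 0 1 : Set ℝ) =ᵐ[volume] Ioc 0 (cdf μ t) := by
    have hIic : VaR (cdf μ) ⁻¹' Iic t ∩ Ioo 0 1 = Iic (cdf μ t) ∩ Ioo 0 1 := by
      ext u
      exact and_congr_left fun hu => VaR_le_iff hu
    have hIoc : Ioc 0 (cdf μ t) = Ioc 0 1 ∩ Iic (cdf μ t) := by
      rw [Ioc_inter_Iic, min_eq_right (cdf_le_one μ t)]
    rw [hIic, inter_comm, hIoc]
    exact Ioo_ae_eq_Ioc.inter (ae_eq_refl _)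
  rw [Measure.map_apply_of_aemeasurable aemeasurable_VaR measurableSet_Iic,
    Measure.restrict_apply' measurableSet_Ioo, measure_congr hpreimage, Real.volume_Ioc, sub_zero,
    ofReal_cdf]

theorem integral_comp_VaR [IsProbabilityMeasure μ] {f : ℝ → ℝ} (hf : Measurable f) :
    ∫ u in Ioo 0 1, f (VaR (cdf μ) u) = ∫ x, f x ∂μ := by
  conv_rhs => rw [← map_VaR_restrict_volume (μ := μ)]
  exact (integral_map aemeasurable_VaR hf.aestronglyMeasurable).symm

theorem integrableOn_comp_VaR [IsProbabilityMeasure μ] {f : ℝ → ℝ}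
    (hfμ : Integrable f μ) : IntegrableOn (fun u => f (VaR (cdf μ) u)) (Ioo 0 1) := by
  rw [← map_VaR_restrict_volume (μ := μ)] at hfμ
  exact hfμ.comp_aemeasurable aemeasurable_VaR

theorem real_eq_volume_preimage_VaR [IsProbabilityMeasure μ] {s : Set ℝ} (hs : MeasurableSet s) :
    μ.real s = volume.real (VaR (cdf μ) ⁻¹' s ∩ Ioo 0 1) := by
  rw [← measureReal_restrict_apply' measurableSet_Ioo,
    ← map_measureReal_apply_of_aemeasurable aemeasurable_VaR hs, map_VaR_restrict_volume]

theorem real_Ioi_VaR_le [IsProbabilityMeasure μ] (hu : u ∈ Ioo 0 1) :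
    μ.real (Ioi (VaR (cdf μ) u)) ≤ 1 - u := by
  have hcompl := probReal_compl_eq_one_sub (μ := μ) (measurableSet_Iic (a := VaR (cdf μ) u))
  rw [compl_Iic, ← cdf_eq_real] at hcompl
  linarith [(VaR_le_iff (μ := μ) hu).1 le_rfl]

theorem le_real_Ici_VaR [IsProbabilityMeasure μ] (hu : u ∈ Ioo 0 1) :
    1 - u ≤ μ.real (Ici (VaR (cdf μ) u)) := by
  have hsub : Ico u 1 ⊆ VaR (cdf μ) ⁻¹' Ici (VaR (cdf μ) u) ∩ Ioo 0 1 := fun w hw =>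
    have hw' : w ∈ Ioo 0 1 := ⟨hu.1.trans_le hw.1, hw.2⟩
    ⟨monotoneOn_VaR hu hw' hw.1, hw'⟩
  calc 1 - u = volume.real (Ico u 1) := by rw [Real.volume_real_Ico_of_le hu.2.le]
    _ ≤ volume.real (VaR (cdf μ) ⁻¹' Ici (VaR (cdf μ) u) ∩ Ioo 0 1) :=
      measureReal_mono hsub ((measure_mono inter_subset_right).trans_lt measure_Ioo_lt_top).ne
    _ = μ.real (Ici (VaR (cdf μ) u)) := (real_eq_volume_preimage_VaR measurableSet_Ici).symm

end Quantile

/-- The expected excess `E[(X - t)⁺]` over `t` of a loss `X` with law `μ`. The expected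
shortfall is the minimum of `t + stopLoss μ t / α` over `t`. -/
noncomputable def stopLoss (μ : Measure ℝ) (t : ℝ) : ℝ := ∫ x, max (x - t) 0 ∂μ

section StopLoss

variable {μ : Measure ℝ} {α : ℝ}

theorem integrable_max_sub_zero [IsFiniteMeasure μ] (hμ : Integrable (fun x => max x 0) μ)
    (t : ℝ) : Integrable (fun x => max (x - t) 0) μ := by
  refine (hμ.add (integrable_const |t|)).mono' (by fun_prop) (.of_forall fun x => ?_)
  rw [Real.norm_of_nonneg (le_max_right _ _)]
  exact max_le (by simp only [Pi.add_apply]; linarith [le_max_left x 0, neg_le_abs t])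
    (add_nonneg (le_max_right x 0) (abs_nonneg t))

theorem intervalIntegrable_VaR [IsProbabilityMeasure μ] (hα : α ∈ Ioo 0 1)
    (hμ : Integrable (fun x => max x 0) μ) :
    IntervalIntegrable (VaR (cdf μ)) volume (1 - α) 1 := by
  have hα' : 1 - α ∈ Ioo 0 1 := Ioo.one_sub_mem hα
  have hsub : Ioo (1 - α) 1 ⊆ Ioo 0 1 := Ioo_subset_Ioo_left hα'.1.le
  rw [intervalIntegrable_iff_integrableOn_Ioo_of_le hα'.2.le]
  have hbound : IntegrableOn (fun u => max (VaR (cdf μ) u - VaR (cdf μ) (1 - α)) 0 +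
      VaR (cdf μ) (1 - α)) (Ioo (1 - α) 1) :=
    ((integrableOn_comp_VaR (integrable_max_sub_zero hμ _)).mono_set hsub).add (by simp)
  refine hbound.congr_fun (fun u hu => ?_) measurableSet_Ioo
  have hle := monotoneOn_VaR (μ := μ) hα' (hsub hu) hu.1.le
  simp only [max_eq_left (sub_nonneg.2 hle), sub_add_cancel]

theorem mul_ES_eq_setIntegral (hα : 0 < α) (F : ℝ → ℝ) :
    α * ES α F = ∫ u in Ioo (1 - α) 1, VaR F u := by
  rw [ES, ← mul_assoc, mul_one_div_cancel hα.ne', one_mul,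
    intervalIntegral.integral_of_le (by linarith), integral_Ioc_eq_integral_Ioo]

theorem stopLoss_eq_setIntegral [IsProbabilityMeasure μ] (t : ℝ) :
    stopLoss μ t = ∫ u in Ioo 0 1, max (VaR (cdf μ) u - t) 0 :=
  (integral_comp_VaR (f := fun x => max (x - t) 0) (by fun_prop)).symm

theorem mul_ES_eq_add_setIntegral [IsProbabilityMeasure μ] (hα : α ∈ Ioo 0 1)
    (hμ : Integrable (fun x => max x 0) μ) (t : ℝ) :
    α * ES α (cdf μ) = α * t + ∫ u in Ioo (1 - α) 1, (VaR (cdf μ) u - t) := by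
  have hVaR := intervalIntegrable_VaR hα hμ
  rw [intervalIntegrable_iff_integrableOn_Ioo_of_le (by linarith [hα.1])] at hVaR
  rw [mul_ES_eq_setIntegral hα.1, integral_sub hVaR (by simp)]
  simp [hα.1.le]

/-- One half of the Rockafellar–Uryasev formula. -/
theorem mul_ES_le [IsProbabilityMeasure μ] (hα : α ∈ Ioo 0 1)
    (hμ : Integrable (fun x => max x 0) μ) (t : ℝ) :
    α * ES α (cdf μ) ≤ α * t + stopLoss μ t := by
  have hVaR := intervalIntegrable_VaR hα hμ
  rw [intervalIntegrable_iff_integrableOn_Ioo_of_le (by linarith [hα.1])] at hVaR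
  have hsub : Ioo (1 - α) 1 ⊆ Ioo 0 1 := Ioo_subset_Ioo_left (by linarith [hα.2])
  have hint := integrableOn_comp_VaR (integrable_max_sub_zero hμ t)
  rw [mul_ES_eq_add_setIntegral hα hμ t, stopLoss_eq_setIntegral]
  gcongr
  calc ∫ u in Ioo (1 - α) 1, (VaR (cdf μ) u - t)
      ≤ ∫ u in Ioo (1 - α) 1, max (VaR (cdf μ) u - t) 0 :=
        integral_mono (hVaR.sub (by simp)) (hint.mono_set hsub) fun u => le_max_left _ _
    _ ≤ ∫ u in Ioo 0 1, max (VaR (cdf μ) u - t) 0 :=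
        setIntegral_mono_set hint (.of_forall fun u => le_max_right _ _) hsub.eventuallyLE

/-- The other half of the Rockafellar–Uryasev formula: the value at risk is a minimiser. -/
theorem mul_ES_eq [IsProbabilityMeasure μ] (hα : α ∈ Ioo 0 1)
    (hμ : Integrable (fun x => max x 0) μ) :
    α * ES α (cdf μ) = α * VaR (cdf μ) (1 - α) + stopLoss μ (VaR (cdf μ) (1 - α)) := by
  have hα' : 1 - α ∈ Ioo 0 1 := Ioo.one_sub_mem hα
  have hsub : Ioo (1 - α) 1 ⊆ Ioo 0 1 := Ioo_subset_Ioo_left hα'.1.le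
  rw [mul_ES_eq_add_setIntegral hα hμ (VaR (cdf μ) (1 - α)), stopLoss_eq_setIntegral,
    setIntegral_eq_of_subset_of_forall_sdiff_eq_zero measurableSet_Ioo hsub]
  · congr 1
    refine setIntegral_congr_fun measurableSet_Ioo fun u hu => ?_
    exact (max_eq_left (sub_nonneg.2 (monotoneOn_VaR hα' (hsub hu) hu.1.le))).symm
  · rintro u ⟨hu, hu'⟩
    have hle : u ≤ 1 - α := le_of_not_gt fun h => hu' ⟨h, hu.2⟩
    exact max_eq_right (sub_nonpos.2 (monotoneOn_VaR hu hα' hle))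

/-- Both one-sided derivatives of the convex function `stopLoss μ` at `c`, namely `-μ (Ioi c)` and
`-μ (Ici c)`, are subgradients. -/
theorem stopLoss_sub_mul_le [IsFiniteMeasure μ] (hμ : Integrable (fun x => max x 0) μ) {c : ℝ}
    {s : Set ℝ} (hs : MeasurableSet s) (hIoi : Ioi c ⊆ s) (hIci : s ⊆ Ici c) (t : ℝ) :
    stopLoss μ c - (t - c) * μ.real s ≤ stopLoss μ t := by
  have hind : Integrable (s.indicator (1 : ℝ → ℝ)) μ := (integrable_const 1).indicator hs
  have hc := integrable_max_sub_zero hμ c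
  rw [stopLoss, stopLoss, ← integral_indicator_one hs, ← integral_const_mul,
    ← integral_sub hc (hind.const_mul _)]
  refine integral_mono (hc.sub (hind.const_mul _)) (integrable_max_sub_zero hμ t) fun x => ?_
  by_cases hx : x ∈ s
  · have hcx : c ≤ x := hIci hx
    simp [hx, hcx]
  · have hxc : x ≤ c := le_of_not_gt fun h => hx (hIoi h)
    simp [hx, hxc]

theorem mul_abs_ES_sub_ES_le {ν : Measure ℝ} [IsProbabilityMeasure μ] [IsProbabilityMeasure ν]
    (hα : α ∈ Ioo 0 1) (hμ : Integrable (fun x => max x 0) μ)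
    (hν : Integrable (fun x => max x 0) ν) {c d : ℝ} (hc : c = VaR (cdf μ) (1 - α))
    (hd : d = VaR (cdf ν) (1 - α)) :
    α * |ES α (cdf ν) - ES α (cdf μ)| ≤ |stopLoss ν c - stopLoss μ c| +
      |d - c| * (|ν.real (Ioi c) - μ.real (Ioi c)| + |ν.real (Ici c) - μ.real (Ici c)|) := by
  have hα' : 1 - α ∈ Ioo 0 1 := Ioo.one_sub_mem hα
  have hESμ : α * ES α (cdf μ) = α * c + stopLoss μ c := hc ▸ mul_ES_eq hα hμ
  have hESν : α * ES α (cdf ν) = α * d + stopLoss ν d := hd ▸ mul_ES_eq hα hν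
  have hupper : α * ES α (cdf ν) ≤ α * c + stopLoss ν c := mul_ES_le hα hν c
  have hIoi : μ.real (Ioi c) ≤ α := by simpa [hc] using real_Ioi_VaR_le (μ := μ) hα'
  have hIci : α ≤ μ.real (Ici c) := by simpa [hc] using le_real_Ici_VaR (μ := μ) hα'
  have hlower : -(|d - c| * (|ν.real (Ioi c) - μ.real (Ioi c)| +
        |ν.real (Ici c) - μ.real (Ici c)|)) ≤
      α * d + stopLoss ν d - (α * c + stopLoss ν c) := by
    rcases le_total c d with hcd | hdc
    · have hsub :=
        stopLoss_sub_mul_le (c := c) hν measurableSet_Ioi subset_rfl Ioi_subset_Ici_self d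
      rw [abs_of_nonneg (sub_nonneg.2 hcd)]
      nlinarith [le_abs_self (ν.real (Ioi c) - μ.real (Ioi c)),
        abs_nonneg (ν.real (Ici c) - μ.real (Ici c))]
    · have hsub :=
        stopLoss_sub_mul_le (c := c) hν measurableSet_Ici Ioi_subset_Ici_self subset_rfl d
      rw [abs_of_nonpos (sub_nonpos.2 hdc)]
      nlinarith [neg_abs_le (ν.real (Ici c) - μ.real (Ici c)),
        abs_nonneg (ν.real (Ioi c) - μ.real (Ioi c))]
  have hloss := abs_le.1 (le_refl |stopLoss ν c - stopLoss μ c|)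
  rw [← abs_of_pos hα.1, ← abs_mul, abs_of_pos hα.1, abs_le]
  constructor <;> nlinarith [abs_nonneg (stopLoss ν c - stopLoss μ c)]

end StopLoss

section Convergence

variable {ι : Type*} {l : Filter ι} {μ : Measure ℝ} {ν : ι → Measure ℝ} {α : ℝ}

theorem isBoundedUnder_abs_VaR {u : ℝ} (hu : u ∈ Ioo 0 1)
    (hcdf : ∀ q : ℚ, Tendsto (fun k => cdf (ν k) q) l (𝓝 (cdf μ q))) :
    IsBoundedUnder (· ≤ ·) l fun k => |VaR (cdf (ν k)) u| := by
  obtain ⟨a, ha⟩ := (((tendsto_cdf_atBot μ).comp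
    (tendsto_ratCast_atBot_iff.2 tendsto_id)).eventually_lt_const hu.1).exists
  obtain ⟨b, hb⟩ := (((tendsto_cdf_atTop μ).comp
    (tendsto_ratCast_atTop_iff.2 tendsto_id)).eventually_const_lt hu.2).exists
  refine isBoundedUnder_of_eventually_le (a := max |(a : ℝ)| |(b : ℝ)|) ?_
  filter_upwards [(hcdf a).eventually_lt_const ha, (hcdf b).eventually_const_lt hb] with k hka hkb
  exact abs_le_max_abs_abs ((lt_VaR_iff hu).2 hka).le ((VaR_le_iff hu).2 hkb.le)

theorem tendsto_ES [IsProbabilityMeasure μ] [∀ k, IsProbabilityMeasure (ν k)]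
    (hα : α ∈ Ioo 0 1) (hμ : Integrable (fun x => max x 0) μ)
    (hν : ∀ k, Integrable (fun x => max x 0) (ν k)) {c : ℝ} (hc : c = VaR (cdf μ) (1 - α))
    (hloss : Tendsto (fun k => stopLoss (ν k) c) l (𝓝 (stopLoss μ c)))
    (hIoi : Tendsto (fun k => (ν k).real (Ioi c)) l (𝓝 (μ.real (Ioi c))))
    (hIci : Tendsto (fun k => (ν k).real (Ici c)) l (𝓝 (μ.real (Ici c))))
    (hcdf : ∀ q : ℚ, Tendsto (fun k => cdf (ν k) q) l (𝓝 (cdf μ q))) :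
    Tendsto (fun k => ES α (cdf (ν k))) l (𝓝 (ES α (cdf μ))) := by
  have hbdd : IsBoundedUnder (· ≤ ·) l
      ((‖·‖) ∘ fun k => |VaR (cdf (ν k)) (1 - α) - c|) := by
    obtain ⟨R, hR⟩ := isBoundedUnder_abs_VaR (Ioo.one_sub_mem hα) hcdf
    refine isBoundedUnder_of_eventually_le (a := R + |c|) ?_
    filter_upwards [eventually_map.1 hR] with k hk
    simp only [Function.comp_apply, norm_abs_eq_norm]
    exact (norm_sub_le _ _).trans (add_le_add_left hk _)
  have hdist {f : ι → ℝ} {y : ℝ} (hf : Tendsto f l (𝓝 y)) :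
      Tendsto (fun k => |f k - y|) l (𝓝 0) := by
    simpa using (hf.sub_const y).abs
  have hlim : Tendsto (fun k => (|stopLoss (ν k) c - stopLoss μ c| +
      |VaR (cdf (ν k)) (1 - α) - c| * (|(ν k).real (Ioi c) - μ.real (Ioi c)| +
        |(ν k).real (Ici c) - μ.real (Ici c)|)) / α) l (𝓝 0) := by
    have hsum := (hdist hIoi).add (hdist hIci)
    rw [add_zero] at hsum
    have hprod := isBoundedUnder_le_mul_tendsto_zero hbdd hsum
    simpa using ((hdist hloss).add hprod).div_const α
  rw [tendsto_iff_norm_sub_tendsto_zero]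
  refine squeeze_zero (fun _ => norm_nonneg _) (fun k => ?_) hlim
  rw [le_div_iff₀' hα.1, Real.norm_eq_abs]
  exact mul_abs_ES_sub_ES_le hα hμ (hν k) hc rfl

end Convergence

section Empirical

variable {ι κ : Type*} {I : Finset ι} {α : ℝ}

/-- The uniform distribution on the data points `x i` with `i` in `I`; it is the zero measure when
`I` is empty. -/
noncomputable def empiricalMeasure (x : ι → ℝ) (I : Finset ι) : Measure ℝ :=
  ∑ i ∈ I, (I.card : ℝ≥0∞)⁻¹ • Measure.dirac (x i)

theorem isProbabilityMeasure_empiricalMeasure (x : ι → ℝ) (hI : I.Nonempty) :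
    IsProbabilityMeasure (empiricalMeasure x I) := by
  constructor
  simp only [empiricalMeasure, Measure.coe_finsetSum, Finset.sum_apply, Measure.smul_apply,
    measure_univ, smul_eq_mul, mul_one, Finset.sum_const, nsmul_eq_mul]
  exact ENNReal.mul_inv_cancel (by simpa using hI.ne_empty) (by simp)

theorem integrable_empiricalMeasure (x : ι → ℝ) (I : Finset ι) (f : ℝ → ℝ) :
    Integrable f (empiricalMeasure x I) :=
  integrable_finsetSum_measure.2 fun _ hi => (integrable_dirac (by simp)).smul_measure
    (by simpa using Finset.ne_empty_of_mem hi)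

theorem integral_empiricalMeasure (x : ι → ℝ) (I : Finset ι) (f : ℝ → ℝ) :
    ∫ y, f y ∂(empiricalMeasure x I) = (∑ i ∈ I, f (x i)) / I.card := by
  have hint : ∀ i ∈ I, Integrable f ((I.card : ℝ≥0∞)⁻¹ • Measure.dirac (x i)) := fun _ hi =>
    (integrable_dirac (by simp)).smul_measure (by simpa using Finset.ne_empty_of_mem hi)
  rw [empiricalMeasure, integral_finsetSum_measure hint, Finset.sum_div]
  refine Finset.sum_congr rfl fun i _ => ?_
  rw [integral_smul_measure, integral_dirac, ENNReal.toReal_inv, ENNReal.toReal_natCast,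
    smul_eq_mul, div_eq_inv_mul]

theorem cdf_empiricalMeasure (x : ι → ℝ) (hI : I.Nonempty) :
    cdf (empiricalMeasure x I) = empiricalCDF x I := by
  have := isProbabilityMeasure_empiricalMeasure x hI
  ext t
  rw [cdf_eq_real, ← integral_indicator_one measurableSet_Iic, integral_empiricalMeasure]
  simp [empiricalCDF, indicator]

theorem plugIn_congr {x y : ι → ℝ} (h : ∀ i ∈ I, x i = y i) : plugIn α x I = plugIn α y I := by
  have hcdf : empiricalCDF x I = empiricalCDF y I := by
    ext t
    rw [empiricalCDF, empiricalCDF, Finset.filter_congr fun i hi => by rw [h i hi]]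
  rw [plugIn, plugIn, hcdf]

theorem mul_plugIn_le (hα : α ∈ Ioo 0 1) (hI : I.Nonempty) (x y : ι → ℝ) :
    α * plugIn α x I ≤ α * plugIn α y I + (∑ i ∈ I, |x i - y i|) / I.card := by
  have := isProbabilityMeasure_empiricalMeasure x hI
  have := isProbabilityMeasure_empiricalMeasure y hI
  set c := VaR (cdf (empiricalMeasure y I)) (1 - α) with hc
  have hx := mul_ES_le hα (integrable_empiricalMeasure x I _) c
  have hy := mul_ES_eq hα (integrable_empiricalMeasure y I _)
  rw [plugIn, plugIn, ← cdf_empiricalMeasure x hI, ← cdf_empiricalMeasure y hI, hy, ← hc]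
  refine hx.trans ?_
  rw [add_assoc, stopLoss, stopLoss, integral_empiricalMeasure, integral_empiricalMeasure,
    ← add_div, ← Finset.sum_add_distrib]
  gcongr with i
  refine max_le ?_ (add_nonneg (le_max_right _ _) (abs_nonneg _))
  linarith [le_max_left (y i - c) 0, le_abs_self (x i - y i)]

theorem continuous_plugIn (hα : α ∈ Ioo 0 1) (I : Finset ι) :
    Continuous fun x : ι → ℝ => plugIn α x I := by
  rcases I.eq_empty_or_nonempty with rfl | hI
  · exact continuous_const.congr fun x => plugIn_congr (x := 0) (y := x) (by simp)
  refine continuous_iff_continuousAt.2 fun x => tendsto_iff_norm_sub_tendsto_zero.2 ?_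
  have hlim : Tendsto (fun y : ι → ℝ => (∑ i ∈ I, |y i - x i|) / I.card / α) (𝓝 x) (𝓝 0) := by
    have hcont : Continuous fun y : ι → ℝ => (∑ i ∈ I, |y i - x i|) / I.card / α := by fun_prop
    simpa using hcont.tendsto x
  refine squeeze_zero (fun _ => norm_nonneg _) (fun y => ?_) hlim
  have hxy := mul_plugIn_le hα hI x y
  simp only [abs_sub_comm (x _)] at hxy
  rw [le_div_iff₀' hα.1, Real.norm_eq_abs, ← abs_of_pos hα.1, ← abs_mul, abs_of_pos hα.1, abs_le]
  constructor <;> linarith [mul_plugIn_le hα hI y x]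

theorem plugIn_map (e : κ ↪ ι) (x : ι → ℝ) (J : Finset κ) :
    plugIn α x (J.map e) = plugIn α (x ∘ e) J := by
  have hcdf : empiricalCDF x (J.map e) = empiricalCDF (x ∘ e) J := by
    ext t
    simp only [empiricalCDF, Finset.filter_map, Finset.card_map]
    rfl
  rw [plugIn, plugIn, hcdf]

theorem mem_block {N m j : ℕ} {i : Fin N} :
    i ∈ block N m j ↔ j * m ≤ (i : ℕ) ∧ (i : ℕ) < (j + 1) * m := by
  simp [block]

theorem map_valEmbedding_block {N m j : ℕ} (hj : (j + 1) * m ≤ N) :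
    (block N m j).map Fin.valEmbedding = (Finset.range m).map (addLeftEmbedding (j * m)) := by
  rw [Finset.range_eq_Ico, Finset.map_add_left_Ico, add_zero, ← Nat.succ_mul]
  ext k
  simp only [Finset.mem_map, mem_block, Fin.valEmbedding_apply, Finset.mem_Ico]
  exact ⟨by rintro ⟨i, hi, rfl⟩; exact hi, fun hk => ⟨⟨k, hk.2.trans_le hj⟩, hk, rfl⟩⟩

theorem plugIn_block {N m j : ℕ} (hj : (j + 1) * m ≤ N) {x : Fin N → ℝ} {y : ℕ → ℝ}
    (h : ∀ i ∈ block N m j, x i = y i) :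
    plugIn α x (block N m j) = plugIn α (fun i => y (j * m + i)) (Finset.range m) := by
  rw [plugIn_congr h]
  change plugIn α (y ∘ Fin.valEmbedding) (block N m j) = _
  rw [← plugIn_map, map_valEmbedding_block hj, plugIn_map]
  rfl

end Empirical

section Consistency

variable {Ω : Type*} [MeasurableSpace Ω] {P : Measure Ω} {μ : Measure ℝ} {D : ℕ → Ω → ℝ} {α : ℝ}

theorem tendsto_integral_empiricalMeasure_ae (hD : ∀ i, HasLaw (D i) μ P)
    (hindep : Pairwise fun i j => D i ⟂ᵢ[P] D j) {f : ℝ → ℝ} (hf : Measurable f)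
    (hfμ : Integrable f μ) :
    ∀ᵐ ω ∂P, Tendsto (fun m => ∫ x, f x ∂(empiricalMeasure (fun i => D i ω) (Finset.range m)))
      atTop (𝓝 (∫ x, f x ∂μ)) := by
  have hfD : Integrable (f ∘ D 0) P :=
    Integrable.comp_aemeasurable ((hD 0).map_eq.symm ▸ hfμ) (hD 0).aemeasurable
  simp only [integral_empiricalMeasure, Finset.card_range,
    ← (hD 0).integral_comp hf.aestronglyMeasurable]
  exact strong_law_ae_real (fun i => f ∘ D i) hfD (fun i j hij => (hindep hij).comp hf hf)
    fun i => ((hD i).identDistrib (hD 0)).comp hf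

theorem tendsto_real_empiricalMeasure_ae [IsFiniteMeasure μ] (hD : ∀ i, HasLaw (D i) μ P)
    (hindep : Pairwise fun i j => D i ⟂ᵢ[P] D j) {s : Set ℝ} (hs : MeasurableSet s) :
    ∀ᵐ ω ∂P, Tendsto (fun m => (empiricalMeasure (fun i => D i ω) (Finset.range m)).real s)
      atTop (𝓝 (μ.real s)) := by
  simpa only [integral_indicator_one hs] using tendsto_integral_empiricalMeasure_ae hD hindep
    (measurable_one.indicator hs) ((integrable_const (1 : ℝ)).indicator hs)

theorem tendsto_plugIn_ae [IsProbabilityMeasure μ] (hα : α ∈ Ioo 0 1)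
    (hμ : Integrable (fun x => max x 0) μ) (hD : ∀ i, HasLaw (D i) μ P)
    (hindep : Pairwise fun i j => D i ⟂ᵢ[P] D j) :
    ∀ᵐ ω ∂P, Tendsto (fun m => plugIn α (fun i => D i ω) (Finset.range m)) atTop
      (𝓝 (ES α (cdf μ))) := by
  set c := VaR (cdf μ) (1 - α) with hc
  filter_upwards [tendsto_integral_empiricalMeasure_ae hD hindep (f := fun x => max (x - c) 0)
      (by fun_prop) (integrable_max_sub_zero hμ c),
    tendsto_real_empiricalMeasure_ae hD hindep (measurableSet_Ioi (a := c)),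
    tendsto_real_empiricalMeasure_ae hD hindep (measurableSet_Ici (a := c)),
    ae_all_iff.2 fun q : ℚ => tendsto_real_empiricalMeasure_ae hD hindep
      (measurableSet_Iic (a := (q : ℝ)))] with ω hloss hIoi hIci hIic
  have hne (m : ℕ) : (Finset.range (m + 1)).Nonempty := Finset.nonempty_range_add_one
  have hprob (m : ℕ) := isProbabilityMeasure_empiricalMeasure (fun i => D i ω) (hne m)
  have hshift {f : ℕ → ℝ} {y : ℝ} (hf : Tendsto f atTop (𝓝 y)) :
      Tendsto (fun m => f (m + 1)) atTop (𝓝 y) := hf.comp (tendsto_add_atTop_nat 1)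
  rw [← tendsto_add_atTop_iff_nat 1]
  simp only [plugIn, ← cdf_empiricalMeasure _ (hne _)]
  refine tendsto_ES hα hμ (fun m => integrable_empiricalMeasure _ _ _) hc (hshift hloss)
    (hshift hIoi) (hshift hIci) fun q => ?_
  simpa only [cdf_eq_real] using hshift (hIic q)

theorem aemeasurable_plugIn (hα : α ∈ Ioo 0 1) (hD : ∀ i, AEMeasurable (D i) P)
    (I : Finset ℕ) : AEMeasurable (fun ω => plugIn α (fun i => D i ω) I) P :=
  (continuous_plugIn hα I).measurable.comp_aemeasurable (aemeasurable_pi_lambda _ hD)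

theorem tendstoInMeasure_plugIn [IsProbabilityMeasure μ] (hα : α ∈ Ioo 0 1)
    (hμ : Integrable (fun x => max x 0) μ) (hD : ∀ i, HasLaw (D i) μ P)
    (hindep : Pairwise fun i j => D i ⟂ᵢ[P] D j) :
    TendstoInMeasure P (fun m ω => plugIn α (fun i => D i ω) (Finset.range m)) atTop
      fun _ => ES α (cdf μ) :=
  have : IsProbabilityMeasure P := (hD 0).isProbabilityMeasure
  tendstoInMeasure_of_tendsto_ae
    (fun _ => (aemeasurable_plugIn hα (fun i => (hD i).aemeasurable) _).aestronglyMeasurable)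
    (tendsto_plugIn_ae hα hμ hD hindep)

theorem identDistrib_plugIn_shift (hα : α ∈ Ioo 0 1) (hD : ∀ i, HasLaw (D i) μ P)
    (hindep : iIndepFun D P) (a : ℕ) (I : Finset ℕ) :
    IdentDistrib (fun ω => plugIn α (fun i => D (a + i) ω) I)
      (fun ω => plugIn α (fun i => D i ω) I) P P :=
  (IdentDistrib.pi (fun i => (hD (a + i)).identDistrib (hD i))
    (hindep.precomp (add_right_injective a)) hindep).comp (continuous_plugIn hα I).measurable

theorem measure_mul_card_le_card_filter_le {ι : Type*} [Fintype ι] [Nonempty ι]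
    {q : ι → Ω → Prop} [∀ j ω, Decidable (q j ω)] (hq : ∀ j, NullMeasurableSet {ω | q j ω} P)
    {p : ℝ≥0∞} (hp : ∀ j, P {ω | q j ω} ≤ p) {θ : ℝ} (hθ : 0 < θ) :
    P {ω | θ * Fintype.card ι ≤ (Finset.univ.filter fun j => q j ω).card} ≤
      p / ENNReal.ofReal θ := by
  have hcount (ω : Ω) : θ * Fintype.card ι ≤ (Finset.univ.filter fun j => q j ω).card ↔
      ENNReal.ofReal θ * Fintype.card ι ≤ ∑ j, {ω | q j ω}.indicator 1 ω := by
    rw [← ENNReal.ofReal_natCast, ← ENNReal.ofReal_mul hθ.le]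
    simp [indicator_apply, ENNReal.ofReal_le_natCast]
  have hmeas (j : ι) : AEMeasurable ({ω | q j ω}.indicator (1 : Ω → ℝ≥0∞)) P :=
    aemeasurable_one.indicator₀ (hq j)
  have hθ0 : ENNReal.ofReal θ ≠ 0 := by simpa using hθ
  have hcard : (Fintype.card ι : ℝ≥0∞) ≠ 0 := by simp
  simp only [hcount]
  calc P {ω | ENNReal.ofReal θ * Fintype.card ι ≤ ∑ j, {ω | q j ω}.indicator 1 ω}
      ≤ (∫⁻ ω, ∑ j, {ω | q j ω}.indicator 1 ω ∂P) / (ENNReal.ofReal θ * Fintype.card ι) :=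
        meas_ge_le_lintegral_div (Finset.aemeasurable_fun_sum _ fun j _ => hmeas j)
          (mul_ne_zero hθ0 hcard) (by finiteness)
    _ = (∑ j, P {ω | q j ω}) / (ENNReal.ofReal θ * Fintype.card ι) := by
        rw [lintegral_finsetSum' _ fun j _ => hmeas j]
        simp only [lintegral_indicator_one₀ (hq _)]
    _ ≤ (p * Fintype.card ι) / (ENNReal.ofReal θ * Fintype.card ι) := by
        gcongr
        simpa [mul_comm p] using Finset.sum_le_sum fun j (_ : j ∈ Finset.univ) => hp j
    _ = p / ENNReal.ofReal θ := ENNReal.mul_div_mul_right _ _ hcard (by simp)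

end Consistency

section OrderStatistics

variable {n : ℕ} {T : Fin n → ℝ} {e δ : ℝ}

theorem abs_orderStat_sub_lt {k : ℕ} (hk : (Finset.univ.filter fun j => δ ≤ |T j - e|).card ≤ k)
    (hkn : k + (Finset.univ.filter fun j => δ ≤ |T j - e|).card < n) :
    |orderStat T k - e| < δ := by
  have hkn' : k < n := (Nat.le_add_right _ _).trans_lt hkn
  rw [orderStat, dif_pos hkn']
  by_contra! hfar
  have hmono := Tuple.monotone_sort T
  have hcard (s : Finset (Fin n)) (hs : ∀ l ∈ s, δ ≤ |T (Tuple.sort T l) - e|) :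
      s.card ≤ (Finset.univ.filter fun j => δ ≤ |T j - e|).card :=
    Finset.card_le_card_of_injOn (Tuple.sort T) (fun l hl => by simpa using hs l hl)
      (Tuple.sort T).injective.injOn
  rcases le_abs.1 hfar with habove | hbelow
  · have hge := hcard (Finset.Ici ⟨k, hkn'⟩) fun l hl =>
      (habove.trans (sub_le_sub_right (hmono (Finset.mem_Ici.1 hl)) e)).trans (le_abs_self _)
    simp only [Fin.card_Ici] at hge
    omega
  · have hle := hcard (Finset.Iic ⟨k, hkn'⟩) fun l hl =>
      (hbelow.trans (neg_le_neg (sub_le_sub_right (hmono (Finset.mem_Iic.1 hl)) e))).trans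
        (neg_le_abs _)
    simp only [Fin.card_Iic] at hle
    omega

theorem abs_quantile_sub_lt {β : ℝ}
    (hβ : (Finset.univ.filter fun j => δ ≤ |T j - e|).card ≤ β * ((n : ℝ) - 1))
    (hβ' : (Finset.univ.filter fun j => δ ≤ |T j - e|).card < (1 - β) * ((n : ℝ) - 1)) :
    |quantile T β - e| < δ := by
  set b := (Finset.univ.filter fun j => δ ≤ |T j - e|).card
  set h : ℝ := β * ((n : ℝ) - 1)
  have hfloor : (⌊h⌋₊ : ℝ) ≤ h := Nat.floor_le ((Nat.cast_nonneg b).trans hβ)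
  have hfloor' : h < ⌊h⌋₊ + 1 := Nat.lt_floor_add_one h
  have hb : b ≤ ⌊h⌋₊ := Nat.le_floor hβ
  have hbn : ⌊h⌋₊ + 1 + b < n := by
    have hbn' : (⌊h⌋₊ : ℝ) + 1 + b < n := by linarith
    exact_mod_cast hbn'
  have hball := (convex_ball e δ).add_smul_sub_mem
    (mem_ball_iff_norm.2 (abs_orderStat_sub_lt hb (by omega)))
    (mem_ball_iff_norm.2 (abs_orderStat_sub_lt (hb.trans (Nat.le_succ _)) hbn))
    (t := h - ⌊h⌋₊) ⟨by linarith, by linarith⟩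
  exact mem_ball_iff_norm.1 hball

theorem abs_min_max_sub_lt {t p q : ℝ} (hp : |p - e| < δ) (hq : |q - e| < δ) :
    |min (max t p) q - e| < δ := by
  rw [abs_lt] at hp hq ⊢
  have hlower : e - δ < min (max t p) q :=
    lt_min (lt_max_of_lt_right (by linarith)) (by linarith)
  constructor <;> linarith [min_le_right (max t p) q]

end OrderStatistics

section Robustness

variable {α β₁ β₂ ε e δ : ℝ} {N : ℕ}

theorem card_modified_blocks_le {m : ℕ} (s : Finset (Fin N)) :
    (Finset.univ.filter fun j : Fin (N / m) => ∃ i ∈ block N m j, i ∈ s).card ≤ s.card := by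
  rw [← Finset.card_image_of_injective _ Fin.val_injective]
  refine (Finset.card_le_card fun j hj => ?_).trans
    (Finset.card_image_le (s := s) (f := fun i => (i : ℕ) / m))
  obtain ⟨j, hmod, rfl⟩ := Finset.mem_image.1 hj
  obtain ⟨i, hi, his⟩ := (Finset.mem_filter.1 hmod).2
  rw [mem_block] at hi
  exact Finset.mem_image.2 ⟨i, his, Nat.div_eq_of_lt_le hi.1 hi.2⟩

theorem card_atypical_blockEstimates_le (x : Fin N → ℝ) (y : ℕ → ℝ) :
    (Finset.univ.filter fun j => δ ≤ |blockEstimates α ε x j - e|).card ≤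
      (Finset.univ.filter fun i : Fin N => x i ≠ y i).card +
      (Finset.univ.filter fun j : Fin (N / blockSize ε) => δ ≤ |plugIn α
        (fun i => y (j * blockSize ε + i)) (Finset.range (blockSize ε)) - e|).card := by
  refine le_trans ?_ (add_le_add_left (card_modified_blocks_le (m := blockSize ε) _) _)
  refine (Finset.card_le_card fun j hj => ?_).trans (Finset.card_union_le _ _)
  simp only [Finset.mem_union, Finset.mem_filter, Finset.mem_univ, true_and] at hj ⊢
  refine or_iff_not_imp_left.2 fun hclean => ?_
  have hj' : ((j : ℕ) + 1) * blockSize ε ≤ N := Nat.mul_le_of_le_div _ _ _ j.2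
  have hxy : ∀ i ∈ block N (blockSize ε) j, x i = y i := fun i hi => by
    by_contra hne
    exact hclean ⟨i, hi, hne⟩
  rwa [blockEstimates, plugIn_block hj' hxy] at hj

/-- The tolerated proportion of atypical blocks is split into `η` for the blocks that contain
modified data and `ρ` for the unmodified blocks whose estimate is not within `δ` of `e`. -/
theorem abs_estimator_sub_lt {η ρ : ℝ} (hβ₁ : β₁ ∈ Icc (η + ρ) (1 - (η + ρ)))
    (hβ₂ : β₂ ∈ Icc (η + ρ) (1 - (η + ρ))) (hN : 2 ≤ N / blockSize ε) {x : Fin N → ℝ} {y : ℕ → ℝ}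
    (hx : (Finset.univ.filter fun i : Fin N => x i ≠ y i).card ≤
      η * (((N / blockSize ε : ℕ) : ℝ) - 1))
    (hy : (Finset.univ.filter fun j : Fin (N / blockSize ε) => δ ≤ |plugIn α
        (fun i => y (j * blockSize ε + i)) (Finset.range (blockSize ε)) - e|).card <
      ρ / 2 * ((N / blockSize ε : ℕ) : ℝ)) :
    |estimator α β₁ β₂ ε x - e| < δ := by
  have hcard : ((Finset.univ.filter fun j => δ ≤ |blockEstimates α ε x j - e|).card : ℝ) ≤ _ :=
    Nat.cast_le.2 (card_atypical_blockEstimates_le (α := α) (ε := ε) (e := e) (δ := δ) x y)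
  push_cast at hcard
  have hn : (2 : ℝ) ≤ (N / blockSize ε : ℕ) := by exact_mod_cast hN
  have hρ : 0 < ρ / 2 :=
    (pos_iff_pos_of_mul_pos ((Nat.cast_nonneg _).trans_lt hy)).2 (by linarith)
  have hbad : ((Finset.univ.filter fun j => δ ≤ |blockEstimates α ε x j - e|).card : ℝ) <
      (η + ρ) * (((N / blockSize ε : ℕ) : ℝ) - 1) := by
    nlinarith [mul_nonneg hρ.le (sub_nonneg.2 hn)]
  have hquantile {β : ℝ} (hβ : β ∈ Icc (η + ρ) (1 - (η + ρ))) :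
      |quantile (blockEstimates α ε x) β - e| < δ :=
    abs_quantile_sub_lt (hbad.le.trans (by nlinarith [hβ.1]))
      (hbad.trans_le (by nlinarith [hβ.2]))
  exact abs_min_max_sub_lt (hquantile hβ₁) (hquantile hβ₂)

theorem eleven_div_sq (K N : ℕ) :
    11 / (12 * √((K : ℝ) / N)) ^ 2 = 11 / 144 * ((K : ℝ) / N)⁻¹ := by
  rw [mul_pow, Real.sq_sqrt (by positivity), div_eq_mul_inv, mul_inv]
  ring

theorem tendsto_blockSize {K : ℕ → ℕ} (hKpos : ∀ᶠ N in atTop, 1 ≤ K N)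
    (hK : Tendsto (fun N : ℕ => (K N : ℝ) / (N : ℝ)) atTop (𝓝 0)) :
    Tendsto (fun N => blockSize (12 * √((K N : ℝ) / (N : ℝ)))) atTop atTop := by
  simp only [blockSize, eleven_div_sq]
  refine tendsto_nat_ceil_atTop.comp (Tendsto.const_mul_atTop (by norm_num) ?_)
  refine Tendsto.inv_tendsto_nhdsGT_zero (tendsto_nhdsWithin_iff.2 ⟨hK, ?_⟩)
  filter_upwards [hKpos, eventually_gt_atTop 0] with N hKN hN
  have hKN' : (0 : ℝ) < K N := Nat.cast_pos.2 hKN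
  have hN' : (0 : ℝ) < N := Nat.cast_pos.2 hN
  exact div_pos hKN' hN'

/-- Here `13` is an integer below `144 / 11`, the limit of `N / (K m)`. -/
theorem thirteen_mul_le_div_blockSize {K N : ℕ} (hK : 0 < K) (hKN : 1872 * K ≤ N) :
    13 * K ≤ N / blockSize (12 * √((K : ℝ) / N)) := by
  have hK' : (0 : ℝ) < K := by exact_mod_cast hK
  have hKN' : (1872 * K : ℝ) ≤ N := by exact_mod_cast hKN
  have hsize : (blockSize (12 * √((K : ℝ) / N)) : ℝ) < 11 / 144 * ((N : ℝ) / K) + 1 := by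
    rw [blockSize, eleven_div_sq, inv_div]
    exact Nat.ceil_lt_add_one (by positivity)
  have hpos : 0 < blockSize (12 * √((K : ℝ) / N)) := by
    rw [blockSize, eleven_div_sq, Nat.ceil_pos]
    have hN' : (0 : ℝ) < N := by linarith
    positivity
  rw [Nat.le_div_iff_mul_le hpos]
  have hmul : (13 * K : ℝ) * blockSize (12 * √((K : ℝ) / N)) ≤ N :=
    calc (13 * K : ℝ) * blockSize (12 * √((K : ℝ) / N))
        ≤ 13 * K * (11 / 144 * (N / K) + 1) := by gcongr
      _ = 143 / 144 * N + 13 * K := by field_simp; ring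
      _ ≤ N := by linarith
  exact_mod_cast hmul

end Robustness

section Variance

variable {μ : Measure ℝ} {α : ℝ}

theorem lintegral_ofReal_sub_eq_lintegral_measure_Ioi [SFinite μ] (t : ℝ) :
    ∫⁻ x, ENNReal.ofReal (x - t) ∂μ = ∫⁻ s in Ioi t, μ (Ioi s) := by
  have hmeas : Measurable (Function.uncurry fun x s : ℝ => (Ioi s).indicator (1 : ℝ → ℝ≥0∞) x) :=
    measurable_one.indicator (measurableSet_lt measurable_snd measurable_fst)
  calc ∫⁻ x, ENNReal.ofReal (x - t) ∂μ
      = ∫⁻ x, (∫⁻ s in Ioi t, (Iio x).indicator 1 s) ∂μ := by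
        refine lintegral_congr fun x => ?_
        rw [lintegral_indicator_one measurableSet_Iio, Measure.restrict_apply measurableSet_Iio,
          inter_comm, Ioi_inter_Iio, Real.volume_Ioo]
    _ = ∫⁻ x, (∫⁻ s in Ioi t, (Ioi s).indicator 1 x) ∂μ := rfl
    _ = ∫⁻ s in Ioi t, ∫⁻ x, (Ioi s).indicator 1 x ∂μ := lintegral_lintegral_swap hmeas.aemeasurable
    _ = ∫⁻ s in Ioi t, μ (Ioi s) := by simp only [lintegral_indicator_one measurableSet_Ioi]

theorem measure_Ioi_eq_ofReal [IsProbabilityMeasure μ] (t : ℝ) :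
    μ (Ioi t) = ENNReal.ofReal (1 - cdf μ t) := by
  rw [cdf_eq_real, ← probReal_compl_eq_one_sub measurableSet_Iic, compl_Iic, ofReal_measureReal]

/-- The double integral dominates its restriction to the strip `(a, b] × (b, ∞)`, where the
integrand is `F t (1 - F s) ≥ F a (1 - F s)`. -/
theorem mul_lintegral_ofReal_sub_le [IsProbabilityMeasure μ] {a b : ℝ} (hab : a ≤ b) :
    ENNReal.ofReal ((b - a) * cdf μ a) * ∫⁻ x, ENNReal.ofReal (x - b) ∂μ ≤
      ∫⁻ t in Ioi a, ∫⁻ s in Ioi a,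
        ENNReal.ofReal (cdf μ (min t s) - cdf μ t * cdf μ s) := by
  have hstrip {t s : ℝ} (ht : t ∈ Ioc a b) (hs : b < s) : ENNReal.ofReal (cdf μ a) * μ (Ioi s) ≤
      ENNReal.ofReal (cdf μ (min t s) - cdf μ t * cdf μ s) := by
    rw [measure_Ioi_eq_ofReal, ← ENNReal.ofReal_mul (cdf_nonneg μ a),
      min_eq_left (ht.2.trans hs.le)]
    refine ENNReal.ofReal_le_ofReal ?_
    nlinarith [monotone_cdf μ ht.1.le, cdf_le_one μ s]
  have hmeas : Measurable fun s => μ (Ioi s) := by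
    simp only [measure_Ioi_eq_ofReal]
    have hcdf := (monotone_cdf μ).measurable
    fun_prop
  calc ENNReal.ofReal ((b - a) * cdf μ a) * ∫⁻ x, ENNReal.ofReal (x - b) ∂μ
      = ∫⁻ _ in Ioc a b, ∫⁻ s in Ioi b, ENNReal.ofReal (cdf μ a) * μ (Ioi s) := by
        rw [lintegral_ofReal_sub_eq_lintegral_measure_Ioi, lintegral_const_mul _ hmeas,
          setLIntegral_const, Real.volume_Ioc, ENNReal.ofReal_mul (sub_nonneg.2 hab)]
        ring
    _ ≤ ∫⁻ t in Ioc a b, ∫⁻ s in Ioi b,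
          ENNReal.ofReal (cdf μ (min t s) - cdf μ t * cdf μ s) :=
        setLIntegral_mono' measurableSet_Ioc fun _ ht =>
          setLIntegral_mono' measurableSet_Ioi fun _ hs => hstrip ht hs
    _ ≤ ∫⁻ t in Ioi a, ∫⁻ s in Ioi a,
          ENNReal.ofReal (cdf μ (min t s) - cdf μ t * cdf μ s) :=
        lintegral_mono' (Measure.restrict_mono_set _ Ioc_subset_Ioi_self) fun _ =>
          lintegral_mono_set (Ioi_subset_Ioi hab)

theorem integrable_max_zero_of_sigmaSq_ne_top [IsProbabilityMeasure μ] (hα : α ∈ Ioo 0 1)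
    (hσ : sigmaSq α (cdf μ) ≠ ∞) : Integrable (fun x => max x 0) μ := by
  set c := VaR (cdf μ) (1 - α) with hc
  have hcdf : 0 < cdf μ c :=
    (Ioo.one_sub_mem hα).1.trans_le ((VaR_le_iff (Ioo.one_sub_mem hα)).1 le_rfl)
  have hdouble : ∫⁻ t in Ioi c, ∫⁻ s in Ioi c,
      ENNReal.ofReal (cdf μ (min t s) - cdf μ t * cdf μ s) ≠ ∞ := fun htop =>
    hσ (by rw [sigmaSq, ← hc, htop, ENNReal.mul_top (by simpa using hα.1.ne')])
  have htail : ∫⁻ x, ENNReal.ofReal (x - (c + 1)) ∂μ ≠ ∞ := fun htop => by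
    have hle := mul_lintegral_ofReal_sub_le (μ := μ) (le_add_of_nonneg_right (a := c) zero_le_one)
    rw [htop, ENNReal.mul_top (by simpa using hcdf)] at hle
    exact hdouble (top_le_iff.1 hle)
  refine ⟨by fun_prop, ?_⟩
  rw [hasFiniteIntegral_iff_ofReal (.of_forall fun x => le_max_right x 0)]
  calc ∫⁻ x, ENNReal.ofReal (max x 0) ∂μ
      ≤ ∫⁻ x, ENNReal.ofReal (x - (c + 1)) + ENNReal.ofReal (c + 1) ∂μ := by
        refine lintegral_mono fun x => ?_
        simpa using ENNReal.ofReal_add_le (p := x - (c + 1)) (q := c + 1)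
    _ < ∞ := by
        rw [lintegral_add_right _ measurable_const, lintegral_const, measure_univ, mul_one]
        exact ENNReal.add_lt_top.2 ⟨htail.lt_top, ENNReal.ofReal_lt_top⟩

end Variance

section RobustConsistency

variable {Ω : Type*} [MeasurableSpace Ω] {P : Measure Ω} {μ : Measure ℝ} {D : ℕ → Ω → ℝ}
  {α β₁ β₂ : ℝ}

theorem measure_le_abs_estimator_sub_le {ε e δ η ρ : ℝ} {N : ℕ} (hα : α ∈ Ioo 0 1)
    (hρ : 0 < ρ) (hβ₁ : β₁ ∈ Icc (η + ρ) (1 - (η + ρ))) (hβ₂ : β₂ ∈ Icc (η + ρ) (1 - (η + ρ)))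
    (hN : 2 ≤ N / blockSize ε) (hD : ∀ i, HasLaw (D i) μ P) (hindep : iIndepFun D P)
    {x : Ω → Fin N → ℝ} (hx : ∀ᵐ ω ∂P, (Finset.univ.filter fun i => x ω i ≠ D i ω).card ≤
      η * (((N / blockSize ε : ℕ) : ℝ) - 1)) :
    P {ω | δ ≤ |estimator α β₁ β₂ ε (x ω) - e|} ≤
      P {ω | δ ≤ |plugIn α (fun i => D i ω) (Finset.range (blockSize ε)) - e|} /
        ENNReal.ofReal (ρ / 2) := by
  have hset : MeasurableSet {z : ℝ | δ ≤ |z - e|} :=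
    measurableSet_le measurable_const (by fun_prop)
  have hshift (j : Fin (N / blockSize ε)) :=
    identDistrib_plugIn_shift hα hD hindep (j * blockSize ε) (Finset.range (blockSize ε))
  have : Nonempty (Fin (N / blockSize ε)) := ⟨⟨0, by lia⟩⟩
  have hmany : ∀ᵐ ω ∂P, δ ≤ |estimator α β₁ β₂ ε (x ω) - e| →
      ρ / 2 * Fintype.card (Fin (N / blockSize ε)) ≤
        (Finset.univ.filter fun j : Fin (N / blockSize ε) => δ ≤ |plugIn α
          (fun i => D (j * blockSize ε + i) ω) (Finset.range (blockSize ε)) - e|).card := by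
    filter_upwards [hx] with ω hω
    contrapose!
    rw [Fintype.card_fin]
    exact abs_estimator_sub_lt (y := fun i => D i ω) hβ₁ hβ₂ hN hω
  exact (measure_mono_ae hmany).trans (measure_mul_card_le_card_filter_le
    (fun j => (hshift j).aemeasurable_fst.nullMeasurableSet_preimage hset)
    (fun j => ((hshift j).measure_mem_eq hset).le) (half_pos hρ))

theorem eventually_thirteen_mul_le_div_blockSize {K : ℕ → ℕ} (hKpos : ∀ᶠ N in atTop, 1 ≤ K N)
    (hK : Tendsto (fun N : ℕ => (K N : ℝ) / (N : ℝ)) atTop (𝓝 0)) :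
    ∀ᶠ N in atTop, 13 * K N ≤ N / blockSize (12 * √((K N : ℝ) / (N : ℝ))) := by
  filter_upwards [hKpos, hK.eventually_lt_const (show (0 : ℝ) < 1 / 1872 by norm_num),
    eventually_gt_atTop 0] with N hKN hlt hN
  refine thirteen_mul_le_div_blockSize hKN ?_
  rw [div_lt_div_iff₀ (by exact_mod_cast hN) (by norm_num)] at hlt
  have hle : (1872 * K N : ℝ) ≤ N := by linarith
  exact_mod_cast hle

theorem tendstoInMeasure_estimator [IsProbabilityMeasure μ]
    (hα : α ∈ Ioo 0 1) (hβ₁ : β₁ ∈ Ioo (1 / 12) (11 / 12)) (hβ₂ : β₂ ∈ Ioo (1 / 12) (11 / 12))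
    (hμ : Integrable (fun x => max x 0) μ) (hD : ∀ i, HasLaw (D i) μ P) (hindep : iIndepFun D P)
    {K : ℕ → ℕ} (hKpos : ∀ᶠ N in atTop, 1 ≤ K N)
    (hK : Tendsto (fun N : ℕ => (K N : ℝ) / (N : ℝ)) atTop (𝓝 0)) {x : (N : ℕ) → Ω → Fin N → ℝ}
    (hx : ∀ N, ∀ᵐ ω ∂P, (Finset.univ.filter fun i : Fin N => x N ω i ≠ D i ω).card ≤ K N) :
    TendstoInMeasure P
      (fun N ω => estimator α β₁ β₂ (12 * √((K N : ℝ) / (N : ℝ))) (x N ω)) atTop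
      fun _ => ES α (cdf μ) := by
  obtain ⟨ρ, hρ, hmargin⟩ : ∃ ρ > 0, ∀ β ∈ ({β₁, β₂} : Set ℝ),
      β ∈ Icc (1 / 12 + ρ) (1 - (1 / 12 + ρ)) := by
    refine ⟨min (min (β₁ - 1 / 12) (11 / 12 - β₁)) (min (β₂ - 1 / 12) (11 / 12 - β₂)), ?_, ?_⟩
    · simp only [gt_iff_lt, lt_min_iff, sub_pos]
      exact ⟨hβ₁, hβ₂⟩
    · rintro β (rfl | rfl) <;> constructor <;> grind
  have hblock := (tendstoInMeasure_plugIn hα hμ hD fun _ _ hij => hindep.indepFun hij).comp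
    (tendsto_blockSize hKpos hK)
  rw [tendstoInMeasure_iff_norm] at hblock ⊢
  intro δ hδ
  have hbound := ENNReal.Tendsto.div_const (hblock δ hδ) (b := ENNReal.ofReal (ρ / 2))
    (.inr (by simpa using hρ))
  rw [ENNReal.zero_div] at hbound
  refine tendsto_of_tendsto_of_tendsto_of_le_of_le' tendsto_const_nhds hbound
    (.of_forall fun _ => zero_le) ?_
  filter_upwards [hKpos, eventually_thirteen_mul_le_div_blockSize hKpos hK] with N hKN hblocks
  refine measure_le_abs_estimator_sub_le hα hρ (hmargin _ (by simp)) (hmargin _ (by simp))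
    (by lia) hD hindep ?_
  filter_upwards [hx N] with ω hω
  generalize N / blockSize _ = n at hblocks ⊢
  rify at hω hKN hblocks
  linarith

end RobustConsistency
end ExpectedShortfall

theorem mainTheorem8_general {Ω : Type*} [MeasurableSpace Ω] (P : Measure Ω)
    [IsProbabilityMeasure P] (α : ℝ) (hα : α ∈ Set.Ioo 0 1)
    (β₁ β₂ : ℝ) (hβ₁ : β₁ ∈ Set.Ioo (1 / 12) (11 / 12)) (hβ₂ : β₂ ∈ Set.Ioo (1 / 12) (11 / 12))
    (X : Ω → ℝ) (D : ℕ → Ω → ℝ)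
    (hIndep : iIndepFun D P) (hIdent : ∀ i, IdentDistrib (D i) X P P)
    (hX : Integrable (fun x => max x 0) (P.map X))
    (K : ℕ → ℕ) (hKpos : ∀ᶠ N in atTop, 1 ≤ K N)
    (hK : Tendsto (fun N : ℕ => (K N : ℝ) / (N : ℝ)) atTop (𝓝 0))
    (Dmod : (N : ℕ) → Ω → Fin N → ℝ)
    (hmod : ∀ N : ℕ, ∀ᵐ ω ∂P,
      (Finset.univ.filter fun i : Fin N => Dmod N ω i ≠ D i ω).card ≤ K N) :
    IntervalIntegrable (ExpectedShortfall.VaR (cdf (P.map X))) volume (1 - α) 1 ∧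
    TendstoInMeasure P
      (fun (N : ℕ) (ω : Ω) => ExpectedShortfall.estimator α β₁ β₂
        (12 * √((K N : ℝ) / (N : ℝ))) (Dmod N ω))
      atTop (fun _ => ExpectedShortfall.ES α (cdf (P.map X))) := by
  have hlaw (i : ℕ) : HasLaw (D i) (P.map X) P :=
    ⟨(hIdent i).aemeasurable_fst, (hIdent i).map_eq⟩
  have : IsProbabilityMeasure (P.map X) :=
    Measure.isProbabilityMeasure_map (hIdent 0).aemeasurable_snd
  exact ⟨ExpectedShortfall.intervalIntegrable_VaR hα hX,
    ExpectedShortfall.tendstoInMeasure_estimator hα hβ₁ hβ₂ hX hlaw hIndep hKpos hK hmod⟩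

theorem mainTheorem8 {Ω : Type*} [MeasurableSpace Ω] (P : Measure Ω) [IsProbabilityMeasure P]
    -- the level and the hyperparameters of the estimator
    (α : ℝ) (hα0 : 0 < α) (hα : α < 1 / 2)
    (β₁ β₂ : ℝ) (hβ₁ : 0.35 ≤ β₁) (hβ : β₁ ≤ β₂) (hβ₂ : β₂ ≤ 0.65)
    -- the loss `X` and the i.i.d. data `D 0, D 1, ...` with the law of `X`
    (X : Ω → ℝ) (D : ℕ → Ω → ℝ)
    (hIndep : iIndepFun D P) (hIdent : ∀ i, IdentDistrib (D i) X P P)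
    (hσ : ExpectedShortfall.sigmaSq α (cdf (P.map X)) ≠ ∞)
    (hLip : ∃ L : ℝ≥0, ∃ U ∈ 𝓝 (1 - α),
      LipschitzOnWith L (ExpectedShortfall.VaR (cdf (P.map X))) U)
    -- at most `K N` points of the sample of size `N` are modified, in an arbitrary way that may
    -- depend on everything; `K N < N` for large `N` follows from the limit
    (K : ℕ → ℕ) (hKpos : ∀ᶠ N in atTop, 1 ≤ K N)
    (hK : Tendsto (fun N : ℕ => (K N : ℝ) / (N : ℝ)) atTop (𝓝 0))
    (Dmod : (N : ℕ) → Ω → Fin N → ℝ)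
    (hmod : ∀ N : ℕ, ∀ᵐ ω ∂P,
      (Finset.univ.filter fun i : Fin N => Dmod N ω i ≠ D i ω).card ≤ K N) :
    -- the integral that defines the expected shortfall converges
    IntervalIntegrable (ExpectedShortfall.VaR (cdf (P.map X))) volume (1 - α) 1 ∧
    TendstoInMeasure P
      (fun (N : ℕ) (ω : Ω) => ExpectedShortfall.estimator α β₁ β₂
        (12 * √((K N : ℝ) / (N : ℝ))) (Dmod N ω))
      atTop (fun _ => ExpectedShortfall.ES α (cdf (P.map X))) := by
  have : IsProbabilityMeasure (P.map X) :=
    Measure.isProbabilityMeasure_map (hIdent 0).aemeasurable_snd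
  have hα1 : α ∈ Set.Ioo 0 1 := ⟨hα0, by linarith⟩
  exact mainTheorem8_general P α hα1 β₁ β₂ ⟨by linarith, by linarith⟩ ⟨by linarith, by linarith⟩
    X D hIndep hIdent (ExpectedShortfall.integrable_max_zero_of_sigmaSq_ne_top hα1 hσ)
    K hKpos hK Dmod hmod
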